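/- Let $1\le k\le n$ be integers and put $r=n-k+1$. Let $\mathcal X_{j}$ be the set of complex $n\times j$ matrices $X$ with $X^*X=I_j$ (isometries), and $\mathcal Y_{j}=\{XX^*: X\in\mathcal X_{j}\}$ the set of rank-$j$ orthogonal projections of $\mathbb C^n$. For $A\in\mathcal M_n(\mathbb C)$ let $$\Lambda_k(A)=\{\lambda\in\mathbb C: X^*AX=\lambda I_k\text{ for some }X\in\mathcal X_k\}$$ be its $k$-rank numerical range. For a square complex matrix $B$ let $F(B)=\{x^*Bx: x^*x=1\}$ be its numerical range, and for an orthogonal projection $P$ let $$F(PAP|_{\operatorname{ran}P})=\{x^*PAPx: Px=x,\ x^*x=1\}$$ be the numerical range of the compression $PAP$, regarded as an operator on the range of $P$. There is a countable family $\{P_\nu\}_{\nu\in\mathbb N}\subseteq\mathcal Y_{r}$ that is dense in $\mathcal Y_{r}$ with respect to the operator norm, together with isometries $M_\nu\in\mathcal X_{r}$ such that $P_\nu=M_\nu M_\nu^*$ for all $\nu$. Moreover, for every such dense family $\{P_\nu\}$, every choice of $M_\nu\in\mathcal X_{r}$ with $P_\nu=M_\nu M_\nu^*$, and every $A\in\mathcal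 M_n(\mathbb C)$, $$\Lambda_k(A)=\bigcap_{\nu\in\mathbb N}F(P_\nu AP_\nu|_{\operatorname{ran}P_\nu})=\bigcap_{\nu\in\mathbb N}F(M_\nu^*AM_\nu).$$ In particular the countable family can be chosen independently of $A$. -/

import Mathlib

open scoped Matrix

namespace HigherRank

/-- The set of `n × r` isometries: complex matrices `X` with `X* X = I_r`. -/
def isometries (n r : ℕ) : Set (Matrix (Fin n) (Fin r) ℂ) :=
  {X | Xᴴ * X = 1}

/-- The set of rank-`r` orthogonal projections of `ℂⁿ`: the matrices `X X*` with `X` an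
`n × r` isometry. As a subtype of the matrices it carries the (unique) Hausdorff vector space
topology of the finite-dimensional space of matrices, which is that of the operator norm. -/
def projections (n r : ℕ) : Set (Matrix (Fin n) (Fin n) ℂ) :=
  {P | ∃ X ∈ isometries n r, P = X * Xᴴ}

/-- The `k`-rank numerical range of an `n × n` matrix. -/
def rankNumericalRange {n : ℕ} (k : ℕ) (A : Matrix (Fin n) (Fin n) ℂ) : Set ℂ :=
  {z | ∃ X ∈ isometries n k, Xᴴ * A * X = z • (1 : Matrix (Fin k) (Fin k) ℂ)}

/-- The classical numerical range `{x* A x : x* x = 1}`. -/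
def numericalRange {m : ℕ} (A : Matrix (Fin m) (Fin m) ℂ) : Set ℂ :=
  {z | ∃ x : Fin m → ℂ, star x ⬝ᵥ x = 1 ∧ z = star x ⬝ᵥ (A *ᵥ x)}

/-- The numerical range of the compression `P A P`, regarded as an operator on the range of the
projection `P`: the values `x* (P A P) x` at the unit vectors `x` with `P x = x`. -/
def compressionNumericalRange {n : ℕ} (P A : Matrix (Fin n) (Fin n) ℂ) : Set ℂ :=
  {z | ∃ x : Fin n → ℂ, P *ᵥ x = x ∧ star x ⬝ᵥ x = 1 ∧ z = star x ⬝ᵥ ((P * A * P) *ᵥ x)}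

end HigherRank

namespace HigherRank

/-! A point `z` lies in the `k`-rank numerical range exactly when the form `⟪x, (A - z) y⟫` has a
totally isotropic subspace of dimension `k`. Such a subspace meets every subspace of dimension `r =
n - k + 1`, which gives the inclusion from left to right.

Conversely, membership of `z` in the numerical range of the compression is a closed condition on the
projection (`isClosed_mem_compressionNumericalRange`), so it passes from a dense family to all
rank-`r` projections. Then every `r`-dimensional subspace contains a unit vector isotropic for `A -
z`, and no rotation of the form can have negative definite real part on a subspace of dimension `r`
(`negBound_of_forall_mem`).

It remains to find the isotropic subspace (`NegBound.exists_isotropic`), by induction on the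
dimension. A reducing isotropic vector is split off, lowering `k` by one (`NegBound.reduce`).
Without reducing vectors, eigenvectors of the pencil of the form and its adjoint diagonalize the
form with nonzero entries (`exists_orthogonal_family`). After a rotation these entries are positive
multiples of `a j + I` and of `-(b j + I)`. The half plane bound then says that the sorted `a` and
`b` interlace well enough for `diag a` and `diag b` to have a common `k × k` compression
(`exists_compression_diagonal`), and stacking the two compressions makes the form cancel. -/

/-! ### Inverse Cauchy interlacing for real diagonal matrices. -/

open Finset Polynomial in
/-- The inverse of Cauchy interlacing in codimension one, for strictly interlacing data. -/
theorem exists_compression_diagonal_of_lt {N : ℕ} (a : Fin (N + 1) → ℝ) (c : Fin N → ℝ)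
    (h₁ : ∀ i, a i.castSucc < c i) (h₂ : ∀ i, c i < a i.succ) :
    ∃ X : Matrix (Fin (N + 1)) (Fin N) ℝ,
      Xᵀ * X = 1 ∧ Xᵀ * Matrix.diagonal a * X = Matrix.diagonal c := by
  have ha : StrictMono a := Fin.strictMono_iff_lt_succ.2 fun i => (h₁ i).trans (h₂ i)
  have hc : StrictMono c := by
    intro i j hij
    exact (h₂ i).trans_le ((ha.monotone (Fin.succ_le_castSucc_iff.2 hij)).trans (h₁ j).le)
  let D : Fin (N + 1) → ℝ := fun j => ∏ l ∈ univ.erase j, (a j - a l)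
  let R : Fin N → ℝ[X] := fun i => ∏ l ∈ univ.erase i, (X - C (c l))
  let T : Fin (N + 1) → ℝ := fun j => ∏ l, (a j - c l)
  have hT : ∀ i j, (a j - c i) * (R i).eval (a j) = T j := by
    intro i j
    simp only [R, T, eval_prod, eval_sub, eval_X, eval_C]
    exact Finset.mul_prod_erase univ (fun l => a j - c l) (mem_univ i)
  -- Matching `c l` with `a (j.succAbove l)` pairs factors of equal sign: interlacing puts both on
  -- the same side of `a j`.
  have hpos : ∀ j, 0 < T j * D j := by
    intro j
    have : univ.erase j = univ.map j.succAboveEmb := by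
      ext l
      simp only [mem_erase, mem_univ, and_true, mem_map, true_and]
      constructor
      · intro h
        obtain ⟨z, hz⟩ := Fin.exists_succAbove_eq h
        exact ⟨z, hz⟩
      · rintro ⟨z, rfl⟩
        exact Fin.succAbove_ne j z
    simp only [T, D, this, prod_map, ← prod_mul_distrib]
    refine prod_pos fun l _ => ?_
    change 0 < (a j - c l) * (a j - a (j.succAbove l))
    rcases lt_or_ge l.castSucc j with h | h
    · rw [Fin.succAbove_of_castSucc_lt _ _ h]
      exact mul_pos (sub_pos.2 ((h₂ l).trans_le (ha.monotone (Fin.castSucc_lt_iff_succ_le.1 h))))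
        (sub_pos.2 (ha h))
    · rw [Fin.succAbove_of_le_castSucc _ _ h]
      exact mul_pos_of_neg_of_neg (sub_neg.2 ((ha.monotone h).trans_lt (h₁ l)))
        (sub_neg.2 (ha (h.trans_lt Fin.castSucc_lt_succ)))
  -- The sum is the top divided difference of `R i` at the `N + 1` nodes, that is, its coefficient
  -- of degree `N`; but `R i` has degree `N - 1`.
  have hsum : ∀ i, ∑ j, (R i).eval (a j) / D j = 0 := by
    intro i
    have hN : 0 < N := i.pos
    have hdeg : (R i).natDegree = N - 1 := by
      simp only [R]
      rw [natDegree_prod_of_monic _ _ fun l _ => monic_X_sub_C _]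
      simp
    have h := Lagrange.coeff_eq_sum (s := univ) (v := a) ha.injective.injOn (P := R i) (by
      refine degree_le_natDegree.trans_lt ?_
      rw [hdeg, card_univ, Fintype.card_fin]
      exact_mod_cast (by omega : N - 1 < N + 1))
    rw [← h, coeff_eq_zero_of_natDegree_lt]
    rw [hdeg, card_univ, Fintype.card_fin]
    omega
  let ω : Fin (N + 1) → ℝ := fun j => (T j * D j)⁻¹
  have hω : ∀ j, 0 < ω j := fun j => inv_pos.2 (hpos j)
  have hT0 : ∀ j, T j ≠ 0 := fun j h => by simpa [h] using hpos j
  have hD0 : ∀ j, D j ≠ 0 := fun j h => by simpa [h] using hpos j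
  let G : Fin N → Fin N → ℝ := fun i l => ∑ j, ω j * (R i).eval (a j) * (R l).eval (a j)
  -- The weights `ω` satisfy `ω j * (a j - c i) * R i (a j) = 1 / D j`, so the difference of the two
  -- sides is the vanishing sum `hsum l`. Symmetry in `i` and `l` then forces orthogonality of the
  -- `R i`, as the `c i` are distinct.
  have hG : ∀ i l, ∑ j, ω j * a j * (R i).eval (a j) * (R l).eval (a j) = c i * G i l := by
    intro i l
    rw [← sub_eq_zero, ← hsum l]
    simp only [G, mul_sum, ← sum_sub_distrib]
    refine sum_congr rfl fun j _ => ?_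
    have : ω j * T j = (D j)⁻¹ := by
      simp only [ω]
      field_simp [hT0 j, hD0 j]
    rw [div_eq_mul_inv, ← this, ← hT i j]
    ring
  have hG0 : ∀ i l, i ≠ l → G i l = 0 := by
    intro i l hil
    have h1 := hG i l
    have h2 := hG l i
    have h3 : G l i = G i l := sum_congr rfl fun j _ => by ring
    have h4 : ∑ j, ω j * a j * (R l).eval (a j) * (R i).eval (a j)
        = ∑ j, ω j * a j * (R i).eval (a j) * (R l).eval (a j) := sum_congr rfl fun j _ => by ring
    rw [h4, h1, h3] at h2
    have h5 : (c i - c l) * G i l = 0 := by linarith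
    exact (mul_eq_zero.1 h5).resolve_left (sub_ne_zero.2 (hc.injective.ne hil))
  have hGp : ∀ i, 0 < G i i := by
    intro i
    refine sum_pos (fun j _ => ?_) univ_nonempty
    have h0 : (R i).eval (a j) ≠ 0 := fun h => hT0 j (by rw [← hT i j, h, mul_zero])
    have := hω j
    rw [mul_assoc]
    exact mul_pos this (mul_self_pos.2 h0)
  have key : ∀ (f : Fin (N + 1) → ℝ) (i l : Fin N),
      ∑ j, (√(ω j) * (R i).eval (a j) / √(G i i)) * f j * (√(ω j) * (R l).eval (a j) / √(G l l))
        = (∑ j, ω j * f j * (R i).eval (a j) * (R l).eval (a j)) / (√(G i i) * √(G l l)) := by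
    intro f i l
    rw [sum_div]
    refine sum_congr rfl fun j _ => ?_
    rw [div_mul_eq_mul_div, div_mul_div_comm]
    congr 1
    linear_combination (R i).eval (a j) * f j * (R l).eval (a j) * Real.mul_self_sqrt (hω j).le
  refine ⟨Matrix.of fun j i => √(ω j) * (R i).eval (a j) / √(G i i), ?_, ?_⟩
  · ext i l
    have h := key 1 i l
    simp only [Pi.one_apply, mul_one] at h
    rw [Matrix.mul_apply]
    simp only [Matrix.transpose_apply, Matrix.of_apply]
    rw [h]
    change G i l / _ = _
    rcases eq_or_ne i l with rfl | hil
    · rw [Real.mul_self_sqrt (hGp i).le, Matrix.one_apply_eq, div_self (hGp i).ne']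
    · rw [hG0 i l hil, zero_div, Matrix.one_apply_ne hil]
  · ext i l
    have h := key a i l
    rw [Matrix.mul_apply]
    simp only [Matrix.mul_diagonal, Matrix.transpose_apply, Matrix.of_apply]
    rw [h, hG]
    rcases eq_or_ne i l with rfl | hil
    · rw [Real.mul_self_sqrt (hGp i).le, Matrix.diagonal_apply_eq, mul_div_assoc,
        div_self (hGp i).ne', mul_one]
    · rw [hG0 i l hil, mul_zero, zero_div, Matrix.diagonal_apply_ne _ hil]

/-- Real matrices with orthonormal columns form a compact set. -/
theorem isCompact_orthonormal_columns (m n : ℕ) :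
    IsCompact {X : Matrix (Fin m) (Fin n) ℝ | Xᵀ * X = 1} := by
  have hcl : IsClosed {X : Matrix (Fin m) (Fin n) ℝ | Xᵀ * X = 1} :=
    isClosed_eq (by fun_prop) continuous_const
  have hcube : IsCompact (Set.univ.pi fun _ : Fin m => Set.univ.pi fun _ : Fin n =>
      Set.Icc (-1 : ℝ) 1) :=
    isCompact_univ_pi fun _ => isCompact_univ_pi fun _ => isCompact_Icc
  refine hcube.of_isClosed_subset hcl fun (X : Matrix (Fin m) (Fin n) ℝ) (hX : Xᵀ * X = 1) i _ j _ => ?_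
  have h : ∑ l, X l j * X l j = 1 := by
    have h0 := congrFun (congrFun hX j) j
    rwa [Matrix.mul_apply, Matrix.one_apply_eq] at h0
  have h1 : X i j * X i j ≤ 1 := by
    rw [← h]
    exact Finset.single_le_sum (f := fun l => X l j * X l j) (fun l _ => mul_self_nonneg _)
      (Finset.mem_univ i)
  exact abs_le.1 (by nlinarith [abs_mul_abs_self (X i j), abs_nonneg (X i j)])

/-- The inverse of Cauchy interlacing in codimension one. -/
theorem exists_compression_diagonal_of_le {N : ℕ} (a : Fin (N + 1) → ℝ) (c : Fin N → ℝ)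
    (h₁ : ∀ i, a i.castSucc ≤ c i) (h₂ : ∀ i, c i ≤ a i.succ) :
    ∃ X : Matrix (Fin (N + 1)) (Fin N) ℝ,
      Xᵀ * X = 1 ∧ Xᵀ * Matrix.diagonal a * X = Matrix.diagonal c := by
  let ε : ℕ → ℝ := fun m => 1 / ((m : ℝ) + 1)
  have hε : ∀ m, 0 < ε m := fun m => Nat.one_div_pos_of_nat
  have hε0 : Filter.Tendsto ε Filter.atTop (nhds 0) := tendsto_one_div_add_atTop_nhds_zero_nat
  -- Shifts by even multiples of `ε` for `a` and odd ones for `c` make the interlacing strict;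
  -- compactness of the isometries provides the limit.
  let a' : ℕ → Fin (N + 1) → ℝ := fun m i => a i + ε m * (2 * (i : ℕ))
  let c' : ℕ → Fin N → ℝ := fun m i => c i + ε m * (2 * (i : ℕ) + 1)
  have hX : ∀ m, ∃ X : Matrix (Fin (N + 1)) (Fin N) ℝ,
      Xᵀ * X = 1 ∧ Xᵀ * Matrix.diagonal (a' m) * X = Matrix.diagonal (c' m) := by
    intro m
    refine exists_compression_diagonal_of_lt _ _ (fun i => ?_) fun i => ?_
    · simp only [a', c', Fin.val_castSucc]
      nlinarith [h₁ i, hε m]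
    · simp only [a', c', Fin.val_succ]
      push_cast
      nlinarith [h₂ i, hε m]
  choose X hX1 hX2 using hX
  have : FirstCountableTopology (Matrix (Fin (N + 1)) (Fin N) ℝ) :=
    inferInstanceAs (FirstCountableTopology (Fin (N + 1) → Fin N → ℝ))
  obtain ⟨Y, hY, φ, hφ, hlim⟩ :=
    (isCompact_orthonormal_columns (N + 1) N).tendsto_subseq (x := X) hX1
  refine ⟨Y, hY, ?_⟩
  have hεφ := hε0.comp hφ.tendsto_atTop
  have ha : Filter.Tendsto (fun m => a' (φ m)) Filter.atTop (nhds a) := by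
    refine tendsto_pi_nhds.2 fun i => ?_
    simpa using (hεφ.mul_const (2 * ((i : ℕ) : ℝ))).const_add (a i)
  have hc : Filter.Tendsto (fun m => c' (φ m)) Filter.atTop (nhds c) := by
    refine tendsto_pi_nhds.2 fun i => ?_
    simpa using (hεφ.mul_const (2 * ((i : ℕ) : ℝ) + 1)).const_add (c i)
  have hcont : Continuous fun p : Matrix (Fin (N + 1)) (Fin N) ℝ × (Fin (N + 1) → ℝ) =>
      p.1ᵀ * Matrix.diagonal p.2 * p.1 := by fun_prop
  have hcont' : Continuous fun d : Fin N → ℝ => Matrix.diagonal d := by fun_prop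
  have t1 := (hcont.tendsto (Y, a)).comp (hlim.prodMk_nhds ha)
  have t2 := (hcont'.tendsto c).comp hc
  refine tendsto_nhds_unique t1 (t2.congr fun m => ?_)
  exact (hX2 (φ m)).symm

/-- The Fan–Pall theorem for diagonal matrices: the inverse of Cauchy interlacing in any
codimension. -/
theorem exists_compression_diagonal (q e : ℕ) (a c : ℕ → ℝ) (ha : Monotone a) (hc : Monotone c)
    (h₁ : ∀ i < q, a i ≤ c i) (h₂ : ∀ i < q, c i ≤ a (i + e)) :
    ∃ X : Matrix (Fin (q + e)) (Fin q) ℝ,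
      Xᵀ * X = 1 ∧ Xᵀ * Matrix.diagonal (fun i : Fin (q + e) => a i) * X =
        Matrix.diagonal fun i : Fin q => c i := by
  induction e generalizing a with
  | zero =>
    refine ⟨1, by simp, ?_⟩
    simp only [Matrix.transpose_one, Matrix.one_mul, Matrix.mul_one]
    congr 1
    funext i
    exact le_antisymm (h₁ i i.2) (h₂ i i.2)
  | succ e ih =>
    -- The largest sequence that interlaces `a` and stays below `c` on the first `q` indices; being
    -- largest, it keeps `c i ≤ b (i + e)`.
    let b : ℕ → ℝ := fun i => if i < q then min (c i) (a (i + 1)) else a (i + 1)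
    have hab : ∀ i, a i ≤ b i := by
      intro i
      simp only [b]
      split_ifs with h
      · exact le_min (h₁ i h) (ha (Nat.le_succ i))
      · exact ha (Nat.le_succ i)
    have hba : ∀ i, b i ≤ a (i + 1) := by
      intro i
      simp only [b]
      split_ifs with h
      · exact min_le_right _ _
      · exact le_rfl
    have hb : Monotone b := monotone_nat_of_le_succ fun i => (hba i).trans (hab (i + 1))
    obtain ⟨Y, hY1, hY2⟩ := ih b hb
      (fun i hi => by simp only [b, if_pos hi]; exact min_le_left _ _)
      (fun i hi => by
        simp only [b]
        split_ifs with h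
        · exact le_min (hc (Nat.le_add_right i e)) (h₂ i hi)
        · exact h₂ i hi)
    obtain ⟨Z, hZ1, hZ2⟩ := exists_compression_diagonal_of_le (N := q + e)
      (fun i => a i) (fun i => b i) (fun i => hab i) (fun i => by simpa using hba i)
    refine ⟨Z * Y, ?_, ?_⟩
    · rw [Matrix.transpose_mul, Matrix.mul_assoc, ← Matrix.mul_assoc Zᵀ, hZ1, Matrix.one_mul, hY1]
    · rw [← hY2, ← hZ2, Matrix.transpose_mul]
      simp only [Matrix.mul_assoc]
      rfl

/-! ### Negative definite subspaces and splitting off a reducing vector. -/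

section Forms

open Module Filter Topology

variable {E : Type*} [NormedAddCommGroup E] [InnerProductSpace ℂ E]

/-- The real part of the rotated form `z ⟪x, A x⟫` is negative definite on `W`. -/
def NegDefOn (A : E →ₗ[ℂ] E) (z : ℂ) (W : Submodule ℂ E) : Prop :=
  ∀ x ∈ W, x ≠ 0 → (z * inner ℂ x (A x)).re < 0

/-- No rotation of the form `⟪x, A x⟫` has a subspace of `S` of dimension greater than
`dim S - k` on which its real part is negative definite. -/
def NegBound (A : E →ₗ[ℂ] E) (S : Submodule ℂ E) (k : ℕ) : Prop :=
  ∀ (z : ℂ) (W : Submodule ℂ E), W ≤ S → NegDefOn A z W → finrank ℂ W + k ≤ finrank ℂ S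

/-- A nonzero isotropic vector of `S` for which the left and right orthogonal complements in `S`
coincide up to containing a common hyperplane. -/
def IsReducing (A : E →ₗ[ℂ] E) (S : Submodule ℂ E) (x : E) : Prop :=
  x ∈ S ∧ x ≠ 0 ∧ inner ℂ x (A x) = 0 ∧
    ∃ φ : E →ₗ[ℂ] ℂ, ∀ y ∈ S, φ y = 0 → inner ℂ y (A x) = 0 ∧ inner ℂ x (A y) = 0

variable [FiniteDimensional ℂ E]

/-- Strict negativity on the compact unit sphere of `W` survives small changes of `z`, and scaling
extends it to `W`. This leaves room to perturb the rotation in `NegBound.reduce`. -/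
theorem NegDefOn.eventually {A : E →ₗ[ℂ] E} {z : ℂ} {W : Submodule ℂ E} (h : NegDefOn A z W) :
    ∀ᶠ z' in 𝓝 z, NegDefOn A z' W := by
  have hA : Continuous A := A.continuous_of_finiteDimensional
  have : ProperSpace E := FiniteDimensional.proper ℂ E
  have hK : IsCompact (Metric.sphere (0 : E) 1 ∩ W) :=
    (isCompact_sphere 0 1).inter_right W.closed_of_finiteDimensional
  have key : ∀ᶠ z' in 𝓝 z, ∀ y ∈ Metric.sphere (0 : E) 1 ∩ W,
      (z' * inner ℂ y (A y)).re < 0 := by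
    refine hK.eventually_forall_of_forall_eventually fun y hy => ?_
    have hcont : Continuous fun p : ℂ × E => (p.1 * inner ℂ p.2 (A p.2)).re := by fun_prop
    have hy0 : y ≠ 0 := by
      rintro rfl
      simpa using hy.1
    exact hcont.continuousAt.eventually_lt continuousAt_const (h y hy.2 hy0)
  filter_upwards [key] with z' hz' x hx hx0
  have hn : (0 : ℝ) < ‖x‖ := norm_pos_iff.2 hx0
  have h1 := hz' (((‖x‖⁻¹ : ℝ) : ℂ) • x)
    ⟨by simp [norm_smul, hn.ne'], W.smul_mem _ hx⟩
  rw [map_smul, inner_smul_left, inner_smul_right, Complex.conj_ofReal] at h1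
  have h2 : z' * (((‖x‖⁻¹ : ℝ) : ℂ) * (((‖x‖⁻¹ : ℝ) : ℂ) * inner ℂ x (A x)))
      = ((‖x‖⁻¹ * ‖x‖⁻¹ : ℝ) : ℂ) * (z' * inner ℂ x (A x)) := by
    push_cast
    ring
  rw [h2, Complex.re_ofReal_mul] at h1
  have h3 : 0 < ‖x‖⁻¹ * ‖x‖⁻¹ := by positivity
  by_contra hcon
  exact absurd h1 (not_lt.2 (mul_nonneg h3.le (not_lt.1 hcon)))

/-- A subspace on which a symmetric form is negative definite, orthogonal to an isotropic vector
that is not in the radical, can be enlarged by one dimension. -/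
theorem exists_negative_extension {H : E →ₗ[ℂ] E} (hH : H.IsSymmetric) {S W : Submodule ℂ E}
    (hWS : W ≤ S) (hW : ∀ w ∈ W, w ≠ 0 → (inner ℂ w (H w)).re < 0) {x v : E} (hx : x ∈ S)
    (hv : v ∈ S) (hxx : inner ℂ x (H x) = 0) (hWx : ∀ w ∈ W, inner ℂ w (H x) = 0)
    (hvx : inner ℂ v (H x) ≠ 0) :
    ∃ W' ≤ S, (∀ w ∈ W', w ≠ 0 → (inner ℂ w (H w)).re < 0) ∧
      finrank ℂ W' = finrank ℂ W + 1 := by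
  let p : E →ₗ[ℂ] W := W.orthogonalProjectionOnto.toLinearMap
  have hp : ∀ w ∈ W, ∀ y, inner ℂ w (p y : E) = inner ℂ w y := by
    intro w hw y
    exact Submodule.inner_orthogonalProjectionOnto_eq_of_mem_left ⟨w, hw⟩ y
  let f : W →ₗ[ℂ] W := p ∘ₗ H ∘ₗ W.subtype
  have hf : Function.Injective f := by
    rw [← LinearMap.ker_eq_bot, LinearMap.ker_eq_bot']
    intro w hw
    by_contra hw0
    have h1 := hp w w.2 (H w)
    have h2 : p (H w) = 0 := hw
    rw [h2] at h1
    have h3 := hW w w.2 (by simpa using hw0)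
    rw [← h1] at h3
    simp at h3
  -- The compression of `H` to `W` is bijective by definiteness; subtracting `w₀` makes `v`
  -- orthogonal to `W` for `H`.
  obtain ⟨w₀, hw₀⟩ := (LinearMap.injective_iff_surjective.1 hf) (p (H v))
  set u : E := v - w₀ with hu
  have huS : u ∈ S := S.sub_mem hv (hWS w₀.2)
  have hWu : ∀ w ∈ W, inner ℂ w (H u) = 0 := by
    intro w hw
    have h1 : p (H w₀) = p (H v) := hw₀
    rw [hu, map_sub, inner_sub_right, ← hp w hw (H v), ← h1, hp w hw, sub_self]
  have hux : inner ℂ u (H x) ≠ 0 := by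
    rw [hu, inner_sub_left, hWx _ w₀.2, sub_zero]
    exact hvx
  set d : ℂ := inner ℂ x (H u) with hd
  have hxu : inner ℂ u (H x) = (starRingEnd ℂ) d := by
    rw [hd, inner_conj_symm, hH]
  have hd0 : 0 < Complex.normSq d := by
    refine Complex.normSq_pos.2 fun h => hux ?_
    rw [hxu, h, map_zero]
  obtain ⟨s, hs⟩ : ∃ s : ℝ, -2 * s * Complex.normSq d + (inner ℂ u (H u)).re < 0 := by
    refine ⟨(|(inner ℂ u (H u)).re| + 1) / Complex.normSq d, ?_⟩
    rw [mul_assoc, div_mul_cancel₀ _ hd0.ne']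
    have := le_abs_self (inner ℂ u (H u)).re
    have := abs_nonneg (inner ℂ u (H u)).re
    linarith
  -- Since `x` is isotropic, the value of the form at `y` is affine in `s` with slope `-2 * normSq
  -- d`.
  set y : E := (-(s : ℂ) * d) • x + u with hy
  have hyS : y ∈ S := S.add_mem (S.smul_mem _ hx) huS
  have hWy : ∀ w ∈ W, inner ℂ w (H y) = 0 := by
    intro w hw
    rw [hy, map_add, map_smul, inner_add_right, inner_smul_right, hWx w hw, hWu w hw]
    simp
  have hyy : (inner ℂ y (H y)).re < 0 := by
    have : inner ℂ y (H y) =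
        ((-2 * s * Complex.normSq d : ℝ) : ℂ) + inner ℂ u (H u) := by
      rw [hy, map_add, map_smul, inner_add_left, inner_add_right, inner_add_right,
        inner_smul_left, inner_smul_right, inner_smul_left, inner_smul_right, hxx, hxu, ← hd]
      simp only [map_mul, map_neg, Complex.conj_ofReal]
      push_cast
      rw [Complex.normSq_eq_conj_mul_self]
      ring
    rw [this, Complex.add_re, Complex.ofReal_re]
    exact hs
  have hyW : y ∉ W := by
    intro h
    rw [hWy y h] at hyy
    simp at hyy
  have hy0 : y ≠ 0 := fun h => hyW (h ▸ W.zero_mem)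
  refine ⟨W ⊔ Submodule.span ℂ {y}, sup_le hWS ((Submodule.span_singleton_le_iff_mem _ _).2 hyS),
    ?_, ?_⟩
  · intro t ht ht0
    obtain ⟨w, hw, z, hz, rfl⟩ := Submodule.mem_sup.1 ht
    obtain ⟨c, rfl⟩ := Submodule.mem_span_singleton.1 hz
    have hyw : inner ℂ y (H w) = 0 := by
      rw [← hH, ← inner_conj_symm, hWy w hw, map_zero]
    have : inner ℂ (w + c • y) (H (w + c • y)) =
        inner ℂ w (H w) + ((Complex.normSq c : ℝ) : ℂ) * inner ℂ y (H y) := by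
      rw [map_add, map_smul, inner_add_left, inner_add_right, inner_add_right, inner_smul_left,
        inner_smul_right, inner_smul_left, inner_smul_right, hWy w hw, hyw,
        Complex.normSq_eq_conj_mul_self]
      ring
    rw [this, Complex.add_re, Complex.re_ofReal_mul]
    rcases eq_or_ne w 0 with rfl | hw0
    · have hc : c ≠ 0 := by
        rintro rfl
        simp at ht0
      have := mul_neg_of_pos_of_neg (Complex.normSq_pos.2 hc) hyy
      simpa using this
    · have h1 := hW w hw hw0
      have h2 := mul_nonpos_of_nonneg_of_nonpos (Complex.normSq_nonneg c) hyy.le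
      linarith
  · have hdis : W ⊓ Submodule.span ℂ {y} = ⊥ := by
      rw [← disjoint_iff]
      exact (Submodule.disjoint_span_singleton' hy0).2 hyW
    have := Submodule.finrank_sup_add_finrank_inf_eq W (Submodule.span ℂ {y})
    rw [hdis, finrank_bot, finrank_span_singleton hy0] at this
    simpa using this

/-- The Hermitian part of `z A`, up to the factor `2`. -/
noncomputable def hermPart (A : E →ₗ[ℂ] E) (z : ℂ) : E →ₗ[ℂ] E :=
  z • A + (starRingEnd ℂ) z • LinearMap.adjoint A

theorem inner_hermPart (A : E →ₗ[ℂ] E) (z : ℂ) (x y : E) :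
    inner ℂ x (hermPart A z y) =
      z * inner ℂ x (A y) + (starRingEnd ℂ) (z * inner ℂ y (A x)) := by
  rw [hermPart, LinearMap.add_apply, LinearMap.smul_apply, LinearMap.smul_apply, inner_add_right,
    inner_smul_right, inner_smul_right, LinearMap.adjoint_inner_right, map_mul, inner_conj_symm]

theorem hermPart_isSymmetric (A : E →ₗ[ℂ] E) (z : ℂ) : (hermPart A z).IsSymmetric := by
  intro x y
  rw [← inner_conj_symm, inner_hermPart, inner_hermPart]
  simp only [map_add, Complex.conj_conj]
  ring

theorem re_inner_hermPart_self (A : E →ₗ[ℂ] E) (z : ℂ) (x : E) :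
    (inner ℂ x (hermPart A z x)).re = 2 * (z * inner ℂ x (A x)).re := by
  rw [inner_hermPart, Complex.add_re, Complex.conj_re]
  ring

/-- Splitting off a reducing vector. -/
theorem NegBound.reduce {A : E →ₗ[ℂ] E} {S : Submodule ℂ E} {k : ℕ} (h : NegBound A S (k + 1))
    {x : E} (hx : IsReducing A S x) :
    ∃ S' ≤ S, finrank ℂ S' < finrank ℂ S ∧ NegBound A S' k ∧ x ∉ S' ∧
      ∀ y ∈ S', inner ℂ y (A x) = 0 ∧ inner ℂ x (A y) = 0 := by
  obtain ⟨hxS, hx0, hxx, φ, hφ⟩ := hx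
  let K : Submodule ℂ E := S ⊓ LinearMap.ker (innerₛₗ ℂ (A x)) ⊓
    LinearMap.ker (innerₛₗ ℂ x ∘ₗ A)
  have hK : ∀ y, y ∈ K ↔ y ∈ S ∧ inner ℂ y (A x) = 0 ∧ inner ℂ x (A y) = 0 := by
    intro y
    simp only [K, Submodule.mem_inf, LinearMap.mem_ker, LinearMap.comp_apply, innerₛₗ_apply_apply,
      and_assoc]
    rw [inner_eq_zero_symm]
  have hKS : K ≤ S := fun y hy => ((hK y).1 hy).1
  have hspan : Submodule.span ℂ {x} ≤ K :=
    (Submodule.span_singleton_le_iff_mem _ _).2 ((hK x).2 ⟨hxS, hxx, hxx⟩)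
  have hdim := Submodule.finrank_add_inf_finrank_orthogonal hspan
  rw [finrank_span_singleton hx0] at hdim
  set S' : Submodule ℂ E := (Submodule.span ℂ {x})ᗮ ⊓ K with hS'
  have hS'K : S' ≤ K := inf_le_right
  have hxS' : x ∉ S' := by
    intro hmem
    have := Submodule.mem_orthogonal_singleton_iff_inner_right.1 (Submodule.mem_inf.1 hmem).1
    exact hx0 (inner_self_eq_zero.1 this)
  have hKdim : finrank ℂ S ≤ finrank ℂ K + 1 := by
    have h1 : S ⊓ LinearMap.ker φ ≤ K := fun y hy => (hK y).2 ⟨hy.1, hφ y hy.1 hy.2⟩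
    have h2 := Submodule.finrank_mono h1
    have h3 := Submodule.finrank_sup_add_finrank_inf_eq S (LinearMap.ker φ)
    have h4 := Submodule.finrank_le (S ⊔ LinearMap.ker φ)
    have h5 := LinearMap.finrank_range_add_finrank_ker φ
    have h6 := Submodule.finrank_le (LinearMap.range φ)
    rw [finrank_self] at h6
    omega
  have hlt : finrank ℂ S' < finrank ℂ S := by
    have := Submodule.finrank_mono hKS
    omega
  refine ⟨S', hS'K.trans hKS, hlt, ?_, hxS', fun y hy => ((hK y).1 (hS'K hy)).2⟩
  -- If `x` pairs nontrivially with some `v ∈ S`, then `S'` loses at most two dimensions, but `W`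
  -- can be enlarged by one. Otherwise `K = S` and only one dimension is lost.
  intro z W hW hneg
  by_cases hv : ∃ v ∈ S, ¬ (inner ℂ v (A x) = 0 ∧ inner ℂ x (A v) = 0)
  · obtain ⟨v, hvS, hv⟩ := hv
    -- The pairing is `z * P + conj z * Q`; if it vanished at `z`, `z + t` and `z + t * I`, both `P`
    -- and `Q` would be zero.
    have hz' : ∃ z', NegDefOn A z' W ∧ inner ℂ v (hermPart A z' x) ≠ 0 := by
      have hev := hneg.eventually
      have t1 : Tendsto (fun t : ℝ => z + t) (𝓝[>] 0) (𝓝 z) := by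
        have : Continuous fun t : ℝ => z + (t : ℂ) := by fun_prop
        simpa using (this.tendsto 0).mono_left nhdsWithin_le_nhds
      have t2 : Tendsto (fun t : ℝ => z + t * Complex.I) (𝓝[>] 0) (𝓝 z) := by
        have : Continuous fun t : ℝ => z + (t : ℂ) * Complex.I := by fun_prop
        simpa using (this.tendsto 0).mono_left nhdsWithin_le_nhds
      obtain ⟨t, ⟨h1, h2⟩, ht⟩ := (((t1.eventually hev).and (t2.eventually hev)).and
        self_mem_nhdsWithin).exists
      by_contra hcon
      push Not at hcon
      have e0 := hcon z hneg
      have e1 := hcon _ h1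
      have e2 := hcon _ h2
      rw [inner_hermPart, map_mul] at e0 e1 e2
      simp only [map_add, map_mul, Complex.conj_ofReal, Complex.conj_I] at e1 e2
      have ht0 : (t : ℂ) ≠ 0 := Complex.ofReal_ne_zero.2 (ne_of_gt ht)
      set P := inner ℂ v (A x)
      set Q := (starRingEnd ℂ) (inner ℂ x (A v)) with hQ
      have f1 : (t : ℂ) * (P + Q) = 0 := by linear_combination e1 - e0
      have f2 : (t : ℂ) * Complex.I * (P - Q) = 0 := by linear_combination e2 - e0
      have g1 := (mul_eq_zero.1 f1).resolve_left ht0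
      have g2 := (mul_eq_zero.1 f2).resolve_left (mul_ne_zero ht0 Complex.I_ne_zero)
      have hP : P = 0 := by linear_combination (g1 + g2) / 2
      have hQ0 : Q = 0 := by linear_combination (g1 - g2) / 2
      exact hv ⟨hP, (map_eq_zero _).1 (hQ ▸ hQ0)⟩
    obtain ⟨z', hneg', hvx⟩ := hz'
    obtain ⟨W', hW'S, hW', hdimW'⟩ := exists_negative_extension (hermPart_isSymmetric A z')
      (hW.trans (hS'K.trans hKS)) (fun w hw hw0 => by
        rw [re_inner_hermPart_self]
        linarith [hneg' w hw hw0]) hxS hvS (by rw [inner_hermPart, hxx]; simp)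
      (fun w hw => by
        have := ((hK w).1 (hS'K (hW hw))).2
        rw [inner_hermPart, this.1, this.2]
        simp) hvx
    have := h z' W' hW'S fun w hw hw0 => by
      have := hW' w hw hw0
      rw [re_inner_hermPart_self] at this
      linarith
    omega
  · push Not at hv
    have hKS' : K = S := le_antisymm hKS fun y hy => (hK y).2 ⟨hy, hv y hy⟩
    have := h z W (hW.trans (hS'K.trans hKS)) hneg
    rw [hKS'] at hdim
    omega

end Forms

/-! ### Isotropic subspaces of nonsingular diagonal forms. -/

section Diagonal

open Finset Complex

/-- Every open half plane through the origin contains at most `card ι - k` of the points `z i`. -/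
def HalfPlaneBound {ι : Type*} [Fintype ι] (z : ι → ℂ) (k : ℕ) : Prop :=
  ∀ (ζ : ℂ) (I : Finset ι), (∀ i ∈ I, (ζ * z i).re < 0) → #I + k ≤ Fintype.card ι

/-- Half planes bounded by lines through the origin cut the sorted slopes `a` and `b` at a
threshold, so the bound becomes an interlacing condition between them, and both diagonal matrices
compress to `diag (max a b)`. -/
theorem exists_isotropic_diagonal_sum {p p' k : ℕ} {a b : ℕ → ℝ} (ha : Monotone a)
    (hb : Monotone b) (r : Fin p → ℝ) (r' : Fin p' → ℝ) (hr : ∀ i, 0 < r i) (hr' : ∀ i, 0 < r' i)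
    (h : HalfPlaneBound (Sum.elim (fun j : Fin p => (r j : ℂ) * (a j + I))
      (fun j : Fin p' => -((r' j : ℂ) * (b j + I)))) k) :
    ∃ X : Matrix (Fin p ⊕ Fin p') (Fin k) ℂ, (∀ v, X *ᵥ v = 0 → v = 0) ∧
      Xᴴ * Matrix.diagonal (Sum.elim (fun j : Fin p => (r j : ℂ) * (a j + I))
        (fun j : Fin p' => -((r' j : ℂ) * (b j + I)))) * X = 0 := by
  have h' : ∀ (ζ : ℂ) (s : Finset (Fin p)) (t : Finset (Fin p')),
      (∀ j ∈ s, (ζ * (a j + I)).re < 0) → (∀ j ∈ t, 0 < (ζ * (b j + I)).re) →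
      #s + #t + k ≤ p + p' := by
    intro ζ s t hs ht
    have := h ζ (s.disjSum t) (by
      intro i hi
      rcases Finset.mem_disjSum.1 hi with ⟨j, hj, rfl⟩ | ⟨j, hj, rfl⟩
      · rw [Sum.elim_inl, mul_left_comm, re_ofReal_mul]
        exact mul_neg_of_pos_of_neg (hr j) (hs j hj)
      · rw [Sum.elim_inr, mul_neg, neg_re, mul_left_comm, re_ofReal_mul]
        exact neg_neg_of_pos (mul_pos (hr' j) (ht j hj)))
    simpa using this
  obtain ⟨e, rfl⟩ : ∃ e, p = k + e := by
    have := h' (-I) ∅ univ (by simp) (by simp)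
    refine Nat.exists_eq_add_of_le ?_
    simp at this
    omega
  obtain ⟨e', rfl⟩ : ∃ e', p' = k + e' := by
    have := h' I univ ∅ (by simp) (by simp)
    refine Nat.exists_eq_add_of_le ?_
    simp at this
    omega
  have hab : ∀ i < k, a i ≤ b (i + e') := by
    intro i hi
    by_contra! hlt
    obtain ⟨t, ht1, ht2⟩ := exists_between hlt
    -- This half plane selects the `a j > t` and the `b j < t`: at least `(k + e - i) + (i + e' +
    -- 1)` points, one too many.
    have := h' (-(1 + t * I)) (Ici ⟨i, by omega⟩) (Iic ⟨i + e', by omega⟩)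
      (fun j hj => by
        have : a i ≤ a j := ha (by simpa [Fin.le_def] using hj)
        simp
        linarith)
      (fun j hj => by
        have : b j ≤ b (i + e') := hb (by simpa [Fin.le_def] using hj)
        simp
        linarith)
    rw [Fin.card_Ici, Fin.card_Iic] at this
    simp only at this
    omega
  have hba : ∀ i < k, b i ≤ a (i + e) := by
    intro i hi
    by_contra! hlt
    obtain ⟨t, ht1, ht2⟩ := exists_between hlt
    have := h' (1 + t * I) (Iic ⟨i + e, by omega⟩) (Ici ⟨i, by omega⟩)
      (fun j hj => by
        have : a j ≤ a (i + e) := ha (by simpa [Fin.le_def] using hj)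
        simp
        linarith)
      (fun j hj => by
        have : b i ≤ b j := hb (by simpa [Fin.le_def] using hj)
        simp
        linarith)
    rw [Fin.card_Ici, Fin.card_Iic] at this
    simp only at this
    omega
  have hc : Monotone fun i => max (a i) (b i) := ha.max hb
  obtain ⟨X, hX1, hX2⟩ := exists_compression_diagonal k e a _ ha hc
    (fun i _ => le_max_left _ _) (fun i hi => max_le (ha (Nat.le_add_right i e)) (hba i hi))
  obtain ⟨Y, hY1, hY2⟩ := exists_compression_diagonal k e' b _ hb hc
    (fun i _ => le_max_right _ _) (fun i hi => max_le (hab i hi) (hb (Nat.le_add_right i e')))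
  have hX1' : ∀ l m, ∑ j, X j l * X j m = (1 : Matrix (Fin k) (Fin k) ℝ) l m := by
    intro l m
    rw [← hX1, Matrix.mul_apply]
    rfl
  have hY1' : ∀ l m, ∑ j, Y j l * Y j m = (1 : Matrix (Fin k) (Fin k) ℝ) l m := by
    intro l m
    rw [← hY1, Matrix.mul_apply]
    rfl
  have hXY : ∀ l m, ∑ j : Fin (k + e), X j l * a j * X j m =
      ∑ j : Fin (k + e'), Y j l * b j * Y j m := by
    intro l m
    have h1 := congrFun (congrFun (hX2.trans hY2.symm) l) m
    rw [Matrix.mul_apply, Matrix.mul_apply] at h1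
    simpa only [Matrix.mul_diagonal, Matrix.transpose_apply] using h1
  -- Dividing by the square roots absorbs the weights; the two blocks contribute `diag c + I` and
  -- `-(diag c + I)`.
  refine ⟨Matrix.of (Sum.elim (fun j l => ((X j l / √(r j) : ℝ) : ℂ))
    (fun j l => ((Y j l / √(r' j) : ℝ) : ℂ))), ?_, ?_⟩
  · intro v hv
    have hXv : X.map ofReal *ᵥ v = 0 := by
      funext j
      have h1 := congrFun hv (Sum.inl j)
      simp only [Matrix.mulVec, dotProduct, Matrix.of_apply, Sum.elim_inl, Pi.zero_apply,
        ofReal_div, div_mul_eq_mul_div, ← sum_div] at h1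
      have h2 : (√(r j) : ℂ) ≠ 0 := ofReal_ne_zero.2 (Real.sqrt_pos.2 (hr j)).ne'
      simpa [h2, Matrix.mulVec, dotProduct] using h1
    have h3 : (X.map ofReal)ᵀ * X.map ofReal = (1 : Matrix (Fin k) (Fin k) ℂ) := by
      have h4 := congrArg (fun M : Matrix (Fin k) (Fin k) ℝ => M.map ofRealHom) hX1
      simp only [Matrix.map_mul, Matrix.transpose_map] at h4
      rw [Matrix.map_one _ (map_zero _) (map_one _)] at h4
      exact h4
    rw [← Matrix.one_mulVec v, ← h3, ← Matrix.mulVec_mulVec, hXv, Matrix.mulVec_zero]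
  · ext l m
    rw [Matrix.mul_apply]
    simp only [Matrix.mul_diagonal, Matrix.conjTranspose_apply, Matrix.of_apply,
      Fintype.sum_sum_type, Sum.elim_inl, Sum.elim_inr, Matrix.zero_apply]
    have e1 : ∀ j, star (((X j l / √(r j) : ℝ) : ℂ)) * ((r j : ℂ) * (a j + I)) *
        ((X j m / √(r j) : ℝ) : ℂ) =
          ((X j l * a j * X j m : ℝ) : ℂ) + ((X j l * X j m : ℝ) : ℂ) * I := by
      intro j
      have h2 : (√(r j) : ℂ) ≠ 0 := ofReal_ne_zero.2 (Real.sqrt_pos.2 (hr j)).ne'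
      have h5 : (r j : ℂ) = √(r j) * √(r j) := by
        rw [← ofReal_mul, Real.mul_self_sqrt (hr j).le]
      rw [star_def, conj_ofReal]
      push_cast
      rw [h5]
      field_simp
    have e2 : ∀ j, star (((Y j l / √(r' j) : ℝ) : ℂ)) * (-((r' j : ℂ) * (b j + I))) *
        ((Y j m / √(r' j) : ℝ) : ℂ) =
          -(((Y j l * b j * Y j m : ℝ) : ℂ) + ((Y j l * Y j m : ℝ) : ℂ) * I) := by
      intro j
      have h2 : (√(r' j) : ℂ) ≠ 0 := ofReal_ne_zero.2 (Real.sqrt_pos.2 (hr' j)).ne'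
      have h5 : (r' j : ℂ) = √(r' j) * √(r' j) := by
        rw [← ofReal_mul, Real.mul_self_sqrt (hr' j).le]
      rw [star_def, conj_ofReal]
      push_cast
      rw [h5]
      field_simp
    simp only [e1, e2, sum_neg_distrib, sum_add_distrib, ← sum_mul, ← ofReal_sum, hX1', hY1', hXY]
    ring

theorem exists_sorted_enumeration {P : Type*} [Fintype P] (f : P → ℝ) {p : ℕ}
    (hp : Fintype.card P = p) :
    ∃ (g : ℕ → ℝ) (σ : Fin p ≃ P), Monotone g ∧ ∀ i : Fin p, f (σ i) = g i := by
  let e : Fin p ≃ P := (Fintype.equivFinOfCardEq hp).symm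
  let σ : Fin p ≃ P := (Tuple.sort (f ∘ e)).trans e
  have hσ : Monotone (f ∘ σ) := Tuple.monotone_sort (f ∘ e)
  rcases p with _ | p
  · exact ⟨0, σ, monotone_const, fun i => i.elim0⟩
  -- Capping the index continues the sorted list as a constant, keeping it monotone on all of `ℕ`.
  · refine ⟨fun n => f (σ ⟨min n p, by omega⟩), σ, fun i j hij => hσ (Fin.le_def.2 ?_), fun i => ?_⟩
    · exact min_le_min_right p hij
    · congr 2
      exact Fin.ext (min_eq_left (Nat.le_of_lt_succ i.2)).symm

/-- A nonsingular diagonal form satisfying the half plane bound has a totally isotropic subspace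
of dimension `k`. -/
theorem exists_isotropic_diagonal {ι : Type*} [Fintype ι] [DecidableEq ι] {z : ι → ℂ} {k : ℕ}
    (hz : ∀ i, z i ≠ 0) (h : HalfPlaneBound z k) :
    ∃ X : Matrix ι (Fin k) ℂ, (∀ v, X *ᵥ v = 0 → v = 0) ∧ Xᴴ * Matrix.diagonal z * X = 0 := by
  classical
  -- Each nonzero `z i` excludes at most one `t`, so some rotation moves every entry off the real
  -- axis.
  obtain ⟨t, ht⟩ : ∃ t : ℝ, ∀ i, ((t + I) * z i).im ≠ 0 := by
    have hfin : (⋃ i, {t : ℝ | ((t + I) * z i).im = 0}).Finite := by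
      refine Set.finite_iUnion fun i => Set.Subsingleton.finite fun t ht s hs => ?_
      simp only [Set.mem_ofPred_eq, mul_im, add_re, ofReal_re, I_re, add_zero, add_im, ofReal_im,
        I_im, zero_add, one_mul] at ht hs
      by_contra hts
      have h1 : (t - s) * (z i).im = 0 := by linarith
      have h2 := (mul_eq_zero.1 h1).resolve_left (sub_ne_zero.2 hts)
      rw [h2] at ht
      exact hz i (Complex.ext (by simpa using ht) h2)
    obtain ⟨t, ht⟩ := hfin.exists_notMem
    exact ⟨t, fun i hi => ht (Set.mem_iUnion.2 ⟨i, hi⟩)⟩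
  set η : ℂ := t + I with hη
  have hη0 : η ≠ 0 := by
    intro h0
    have := congrArg Complex.im h0
    simp [hη] at this
  let Q : ι → Prop := fun i => 0 < (η * z i).im
  let f : ι → ℝ := fun i => (η * z i).re / (η * z i).im
  obtain ⟨p, hp⟩ : ∃ p, Fintype.card {i // Q i} = p := ⟨_, rfl⟩
  obtain ⟨p', hp'⟩ : ∃ p, Fintype.card {i // ¬ Q i} = p := ⟨_, rfl⟩
  obtain ⟨a, σ, ha, hσ⟩ := exists_sorted_enumeration (fun i : {i // Q i} => f i) hp
  obtain ⟨b, τ, hb, hτ⟩ := exists_sorted_enumeration (fun i : {i // ¬ Q i} => f i) hp'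
  let ψ : Fin p ⊕ Fin p' ≃ ι := (Equiv.sumCongr σ τ).trans (Equiv.sumCompl Q)
  have hf : ∀ i, η * z i = ((η * z i).im : ℂ) * (f i + I) := by
    intro i
    have h0 : ((η * z i).im : ℂ) ≠ 0 := ofReal_ne_zero.2 (ht i)
    have h1 : ((η * z i).im : ℂ) * f i = (η * z i).re := by
      simp only [f, ofReal_div]
      field_simp
    rw [mul_add, h1, re_add_im]
  have hψ : Sum.elim (fun j : Fin p => ((η * z (σ j)).im : ℂ) * (a j + I))
      (fun j : Fin p' => -(((-(η * z (τ j)).im : ℝ) : ℂ) * (b j + I))) = fun j => η * z (ψ j) := by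
    funext j
    rcases j with j | j
    · simp only [Sum.elim_inl, ← hσ]
      exact (hf (σ j)).symm
    · simp only [Sum.elim_inr, ← hτ, ofReal_neg, neg_mul, neg_neg]
      exact (hf (τ j)).symm
  obtain ⟨X, hX, hXz⟩ := exists_isotropic_diagonal_sum (k := k) ha hb
    (fun j => (η * z (σ j)).im) (fun j => -(η * z (τ j)).im) (fun j => (σ j).2)
    (fun j => neg_pos.2 (lt_of_le_of_ne (not_lt.1 (τ j).2) (ht _))) (by
      rw [hψ]
      intro ζ s hs
      have := h (ζ * η) (s.map ψ.toEmbedding) (by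
        intro i hi
        obtain ⟨j, hj, rfl⟩ := Finset.mem_map.1 hi
        rw [mul_assoc]
        exact hs j hj)
      rwa [card_map, ← Fintype.card_congr ψ] at this)
  rw [hψ] at hXz
  refine ⟨X.submatrix ψ.symm id, fun v hv => hX v ?_, ?_⟩
  · funext j
    have := congrFun hv (ψ j)
    simpa [Matrix.mulVec, dotProduct] using this
  · ext l m
    have h1 := congrFun (congrFun hXz l) m
    rw [Matrix.mul_apply] at h1 ⊢
    simp only [Matrix.mul_diagonal, Matrix.conjTranspose_apply, Matrix.submatrix_apply, id,
      Matrix.zero_apply] at h1 ⊢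
    rw [← Equiv.sum_comp ψ]
    simp only [Equiv.symm_apply_apply]
    have h2 : η * ∑ j, star (X j l) * z (ψ j) * X j m = 0 := by
      rw [← h1, mul_sum]
      exact sum_congr rfl fun j _ => by ring
    exact (mul_eq_zero.1 h2).resolve_left hη0

end Diagonal

/-! ### Diagonalization by the pencil and existence of isotropic subspaces. -/

section Forms

open Module

variable {E : Type*} [NormedAddCommGroup E] [InnerProductSpace ℂ E]

/-- A totally isotropic subspace of dimension `k` of the diagonalizable form `⟪x, A y⟫`. -/
theorem exists_isotropic_of_orthogonal_family {A : E →ₗ[ℂ] E} {m k : ℕ} {S : Submodule ℂ E}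
    (hm : finrank ℂ S = m) (h : NegBound A S k) {e : Fin m → E} (heS : ∀ i, e i ∈ S)
    (he0 : ∀ i, inner ℂ (e i) (A (e i)) ≠ 0)
    (he : ∀ i j, i ≠ j → inner ℂ (e i) (A (e j)) = 0) :
    ∃ U ≤ S, finrank ℂ U = k ∧ ∀ x ∈ U, ∀ y ∈ U, inner ℂ x (A y) = 0 := by
  classical
  have hform : ∀ v w : Fin m → ℂ, inner ℂ (∑ i, v i • e i) (A (∑ i, w i • e i)) =
      ∑ i, star (v i) * inner ℂ (e i) (A (e i)) * w i := by
    intro v w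
    rw [map_sum, sum_inner]
    refine Finset.sum_congr rfl fun i _ => ?_
    rw [inner_sum, Finset.sum_eq_single i]
    · rw [map_smul, inner_smul_left, inner_smul_right, Complex.star_def]
      ring
    · intro j _ hj
      rw [map_smul, inner_smul_left, inner_smul_right, he i j hj.symm, mul_zero, mul_zero]
    · simp
  have hform' : ∀ v : Fin m → ℂ, ∀ i, inner ℂ (e i) (A (∑ i, v i • e i)) =
      inner ℂ (e i) (A (e i)) * v i := by
    intro v i
    rw [map_sum, inner_sum, Finset.sum_eq_single i]
    · rw [map_smul, inner_smul_right, mul_comm]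
    · intro j _ hj
      rw [map_smul, inner_smul_right, he i j hj.symm, mul_zero]
    · simp
  have hli : LinearIndependent ℂ e := by
    rw [Fintype.linearIndependent_iff]
    intro v hv i
    have h1 := hform' v i
    rw [hv, map_zero, inner_zero_right] at h1
    exact (mul_eq_zero.1 h1.symm).resolve_left (he0 i)
  obtain ⟨X, hX, hXA⟩ := exists_isotropic_diagonal (k := k) he0 (by
    intro ζ I hI
    -- The vectors `e i` whose diagonal entries lie in an open half plane span a subspace where the
    -- rotated form is negative definite.
    have h1 := h ζ (Submodule.span ℂ (Set.range fun i : I => e i))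
      (Submodule.span_le.2 (by rintro _ ⟨i, rfl⟩; exact heS i)) (by
        intro x hx hx0
        obtain ⟨c, rfl⟩ := (Submodule.mem_span_range_iff_exists_fun ℂ).1 hx
        have hsum : ∑ i : I, c i • e i =
            ∑ i, (if hi : i ∈ I then c ⟨i, hi⟩ else 0) • e i := by
          rw [← Finset.sum_subset (Finset.subset_univ I), ← Finset.sum_coe_sort I]
          · refine Finset.sum_congr rfl fun i _ => ?_
            rw [dif_pos i.2]
          · intro i _ hi
            rw [dif_neg hi, zero_smul]
        rw [hsum] at hx0 ⊢
        set d : Fin m → ℂ := fun i => if hi : i ∈ I then c ⟨i, hi⟩ else 0 with hd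
        have hdI : ∀ i, d i ≠ 0 → i ∈ I := by
          intro i hi
          by_contra hn
          exact hi (dif_neg hn)
        have hterm : ∀ i, (ζ * (star (d i) * inner ℂ (e i) (A (e i)) * d i)).re =
            Complex.normSq (d i) * (ζ * inner ℂ (e i) (A (e i))).re := by
          intro i
          rw [← Complex.re_ofReal_mul, Complex.normSq_eq_conj_mul_self, Complex.star_def]
          congr 1
          ring
        rw [hform, Finset.mul_sum, Complex.re_sum]
        obtain ⟨i, hi⟩ : ∃ i, d i ≠ 0 := by
          by_contra! hcon
          exact hx0 (Finset.sum_eq_zero fun i _ =>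
            (congrArg (· • e i) (hcon i)).trans (zero_smul ℂ _))
        refine Finset.sum_neg' (fun j _ => ?_) ⟨i, Finset.mem_univ i, ?_⟩
        · rw [hterm]
          rcases eq_or_ne (d j) 0 with h0 | h0
          · simp [h0]
          · exact mul_nonpos_of_nonneg_of_nonpos (Complex.normSq_nonneg _) (hI j (hdI j h0)).le
        · rw [hterm]
          exact mul_neg_of_pos_of_neg (Complex.normSq_pos.2 hi) (hI i (hdI i hi)))
    have hliI : LinearIndependent ℂ fun i : I => e i := hli.comp _ Subtype.val_injective
    rw [finrank_span_eq_card hliI, hm] at h1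
    simpa using h1)
  let u : Fin k → E := fun l => ∑ i, X i l • e i
  have hu : ∀ v : Fin k → ℂ, ∑ l, v l • u l = ∑ i, (X *ᵥ v) i • e i := by
    intro v
    simp only [u, Finset.smul_sum, Matrix.mulVec, dotProduct, Finset.sum_smul, smul_smul]
    rw [Finset.sum_comm]
    simp only [mul_comm]
  have hul : LinearIndependent ℂ u := by
    rw [Fintype.linearIndependent_iff]
    intro v hv
    rw [hu] at hv
    exact congrFun (hX v (funext (Fintype.linearIndependent_iff.1 hli _ hv)))
  refine ⟨Submodule.span ℂ (Set.range u), Submodule.span_le.2 ?_, ?_, ?_⟩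
  · rintro _ ⟨l, rfl⟩
    exact S.sum_mem fun i _ => S.smul_mem _ (heS i)
  · rw [finrank_span_eq_card hul, Fintype.card_fin]
  · intro x hx y hy
    obtain ⟨v, rfl⟩ := (Submodule.mem_span_range_iff_exists_fun ℂ).1 hx
    obtain ⟨w, rfl⟩ := (Submodule.mem_span_range_iff_exists_fun ℂ).1 hy
    rw [hu, hu, hform]
    have h1 : star (X *ᵥ v) ⬝ᵥ (Matrix.diagonal (fun i => inner ℂ (e i) (A (e i))) *ᵥ (X *ᵥ w))
        = 0 := by
      rw [Matrix.star_mulVec, ← Matrix.dotProduct_mulVec, Matrix.mulVec_mulVec,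
        Matrix.mulVec_mulVec, hXA, Matrix.zero_mulVec, dotProduct_zero]
    rw [← h1]
    simp only [dotProduct, Matrix.mulVec_diagonal, Pi.star_apply, mul_assoc]

variable [FiniteDimensional ℂ E]

/-- The pencil of a form and its adjoint has an eigenvector in every nonzero subspace. -/
theorem exists_pencil_eigenvector (A : E →ₗ[ℂ] E) {S : Submodule ℂ E} (hS : S ≠ ⊥) :
    ∃ x ∈ S, x ≠ 0 ∧ ∃ α β : ℂ, (α ≠ 0 ∨ β ≠ 0) ∧
      ∀ y ∈ S, α * inner ℂ y (A x) = β * inner ℂ (A y) x := by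
  let B : S →ₗ[ℂ] S := S.orthogonalProjectionOnto.toLinearMap ∘ₗ A ∘ₗ S.subtype
  have hB : ∀ x y : S, inner ℂ y (B x) = inner ℂ (y : E) (A x) := fun x y =>
    Submodule.inner_orthogonalProjectionOnto_eq_of_mem_left y (A x)
  have : Nontrivial S := (Submodule.nontrivial_iff_ne_bot).2 hS
  by_cases hinj : Function.Injective B
  -- An eigenvector of `B⁻¹ B*` solves the pencil equation; for singular `B`, a kernel vector does.
  · let T : End ℂ S := (LinearEquiv.ofInjectiveEndo B hinj).symm.toLinearMap ∘ₗ LinearMap.adjoint B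
    obtain ⟨μ, hμ⟩ := Module.End.exists_eigenvalue T
    obtain ⟨x, hx⟩ := hμ.exists_hasEigenvector
    refine ⟨x, x.2, by simpa using hx.2, μ, 1, Or.inr one_ne_zero, fun y hy => ?_⟩
    have h1 : LinearMap.adjoint B x = μ • B x := by
      have h2 : T x = μ • x := hx.apply_eq_smul
      have h3 := congrArg (LinearEquiv.ofInjectiveEndo B hinj) h2
      simpa [T] using h3
    have h4 : inner ℂ (⟨y, hy⟩ : S) (LinearMap.adjoint B x) = inner ℂ (A y) (x : E) := by
      rw [LinearMap.adjoint_inner_right, ← inner_conj_symm, hB, inner_conj_symm]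
    rw [one_mul, ← h4, h1, inner_smul_right, hB]
  · rw [← LinearMap.ker_eq_bot, Submodule.eq_bot_iff] at hinj
    push Not at hinj
    obtain ⟨x, hx, hx0⟩ := hinj
    refine ⟨x, x.2, by simpa using hx0, 1, 0, Or.inl one_ne_zero, fun y hy => ?_⟩
    rw [one_mul, zero_mul, ← hB x ⟨y, hy⟩, LinearMap.mem_ker.1 hx, inner_zero_right]

/-- A form without reducing vectors can be diagonalized. -/
theorem exists_orthogonal_family (A : E →ₗ[ℂ] E) (m : ℕ) (S : Submodule ℂ E)
    (hm : finrank ℂ S = m) (hS : ∀ x, ¬ IsReducing A S x) :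
    ∃ e : Fin m → E, (∀ i, e i ∈ S) ∧ (∀ i, inner ℂ (e i) (A (e i)) ≠ 0) ∧
      ∀ i j, i ≠ j → inner ℂ (e i) (A (e j)) = 0 := by
  induction m generalizing S with
  | zero => exact ⟨Fin.elim0, fun i => i.elim0, fun i => i.elim0, fun i => i.elim0⟩
  | succ m ih =>
    obtain ⟨x, hxS, hx0, α, β, hαβ, hxy⟩ := exists_pencil_eigenvector A (S := S) (by
      rintro rfl
      simp at hm)
    -- For a pencil eigenvector, one of the two pairings with `x` vanishes wherever the other does,
    -- so an isotropic one would be reducing.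
    have hxx : inner ℂ x (A x) ≠ 0 := by
      intro h0
      refine hS x ⟨hxS, hx0, h0, ?_⟩
      rcases hαβ with h | h
      · refine ⟨innerₛₗ ℂ x ∘ₗ A, fun y hy hφ => ?_⟩
        have h1 : inner ℂ x (A y) = 0 := hφ
        have h2 := hxy y hy
        rw [inner_eq_zero_symm.1 h1, mul_zero] at h2
        exact ⟨(mul_eq_zero.1 h2).resolve_left h, h1⟩
      · refine ⟨innerₛₗ ℂ (A x), fun y hy hφ => ?_⟩
        have h1 : inner ℂ (A x) y = 0 := hφ
        have h2 := hxy y hy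
        rw [inner_eq_zero_symm.1 h1, mul_zero] at h2
        exact ⟨inner_eq_zero_symm.1 h1,
          inner_eq_zero_symm.1 ((mul_eq_zero.1 h2.symm).resolve_left h)⟩
    have hxx' : inner ℂ (A x) x ≠ 0 := fun h => hxx (inner_eq_zero_symm.1 h)
    have hα : α ≠ 0 := by
      rintro rfl
      have h2 := hxy x hxS
      rw [zero_mul] at h2
      exact (hαβ.resolve_left (by simp)) ((mul_eq_zero.1 h2.symm).resolve_right hxx')
    let K : Submodule ℂ E := S ⊓ LinearMap.ker (innerₛₗ ℂ x ∘ₗ A)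
    have hK : ∀ y, y ∈ K ↔ y ∈ S ∧ inner ℂ x (A y) = 0 := fun y => Iff.rfl
    have hK' : ∀ y ∈ K, inner ℂ y (A x) = 0 := by
      intro y hy
      have h2 := hxy y ((hK y).1 hy).1
      rw [inner_eq_zero_symm.1 ((hK y).1 hy).2, mul_zero] at h2
      exact (mul_eq_zero.1 h2).resolve_left hα
    have hsplit : ∀ y ∈ S, y - (inner ℂ x (A y) / inner ℂ x (A x)) • x ∈ K := by
      intro y hy
      refine (hK _).2 ⟨S.sub_mem hy (S.smul_mem _ hxS), ?_⟩
      rw [map_sub, map_smul, inner_sub_right, inner_smul_right, div_mul_cancel₀ _ hxx, sub_self]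
    have hxK : x ∉ K := fun h => hxx ((hK x).1 h).2
    have hsup : K ⊔ Submodule.span ℂ {x} = S := by
      refine le_antisymm (sup_le inf_le_left ((Submodule.span_singleton_le_iff_mem _ _).2 hxS))
        fun y hy => ?_
      rw [← sub_add_cancel y ((inner ℂ x (A y) / inner ℂ x (A x)) • x)]
      exact Submodule.add_mem_sup (hsplit y hy)
        (Submodule.smul_mem _ _ (Submodule.mem_span_singleton_self x))
    have hKm : finrank ℂ K = m := by
      have h1 := Submodule.finrank_sup_add_finrank_inf_eq K (Submodule.span ℂ {x})
      rw [disjoint_iff.1 ((Submodule.disjoint_span_singleton' hx0).2 hxK), finrank_bot,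
        finrank_span_singleton hx0, hsup, hm] at h1
      omega
    -- A reducing vector of `K` would be reducing in `S`: its functional is pulled back along the
    -- projection onto `K` with kernel spanned by `x`.
    obtain ⟨e, heK, he0, he⟩ := ih K hKm (by
      rintro y ⟨hyK, hy0, hyy, φ, hφ⟩
      refine hS y ⟨((hK y).1 hyK).1, hy0, hyy,
        φ ∘ₗ (LinearMap.id - (LinearMap.toSpanSingleton ℂ E x) ∘ₗ
          ((inner ℂ x (A x))⁻¹ • (innerₛₗ ℂ x ∘ₗ A))), fun w hw hw0 => ?_⟩
      have h1 := hφ _ (hsplit w hw) (by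
        rw [div_eq_inv_mul]
        exact hw0)
      rw [inner_sub_left, inner_smul_left, ((hK y).1 hyK).2, map_sub, map_smul, inner_sub_right,
        inner_smul_right, hK' y hyK] at h1
      simpa using h1)
    refine ⟨Fin.cons x e, Fin.cases hxS fun i => ((hK _).1 (heK i)).1,
      Fin.cases hxx fun i => he0 i, Fin.cases (Fin.cases (fun h => absurd rfl h) fun j _ => ?_)
        fun i => Fin.cases (fun _ => ?_) fun j hij => ?_⟩
    · exact ((hK _).1 (heK j)).2
    · exact hK' _ (heK i)
    · exact he i j fun h => hij (by rw [h])

/-- If no rotation of the form `⟪x, A y⟫` is negative definite on a subspace of `S` of dimension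
greater than `dim S - k`, then `S` contains a totally isotropic subspace of dimension `k`. -/
theorem NegBound.exists_isotropic {A : E →ₗ[ℂ] E} {k : ℕ} {S : Submodule ℂ E}
    (h : NegBound A S k) :
    ∃ U ≤ S, finrank ℂ U = k ∧ ∀ x ∈ U, ∀ y ∈ U, inner ℂ x (A y) = 0 := by
  induction hd : finrank ℂ S using Nat.strong_induction_on generalizing S k with
  | _ d ih =>
    by_cases hred : ∃ x, IsReducing A S x
    · obtain ⟨x, hx⟩ := hred
      rcases k with _ | k
      · refine ⟨⊥, bot_le, finrank_bot ℂ E, fun x hx y _ => ?_⟩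
        rw [(Submodule.mem_bot ℂ).1 hx, inner_zero_left]
      · obtain ⟨S', hS'S, hlt, hS', hxS', horth⟩ := h.reduce hx
        obtain ⟨U, hUS', hU, hiso⟩ := ih _ (hd ▸ hlt) hS' rfl
        have hxU : x ∉ U := fun h => hxS' (hUS' h)
        refine ⟨U ⊔ Submodule.span ℂ {x}, sup_le (hUS'.trans hS'S)
          ((Submodule.span_singleton_le_iff_mem _ _).2 hx.1), ?_, ?_⟩
        · have h1 := Submodule.finrank_sup_add_finrank_inf_eq U (Submodule.span ℂ {x})
          rw [disjoint_iff.1 ((Submodule.disjoint_span_singleton' hx.2.1).2 hxU), finrank_bot,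
            finrank_span_singleton hx.2.1, hU] at h1
          omega
        · intro y' hyx w' hwx
          obtain ⟨y, hy, _, hy', rfl⟩ := Submodule.mem_sup.1 hyx
          obtain ⟨c, rfl⟩ := Submodule.mem_span_singleton.1 hy'
          obtain ⟨w, hw, _, hw', rfl⟩ := Submodule.mem_sup.1 hwx
          obtain ⟨c', rfl⟩ := Submodule.mem_span_singleton.1 hw'
          rw [map_add, map_smul, inner_add_left, inner_add_right, inner_add_right,
            inner_smul_left, inner_smul_right, inner_smul_left, inner_smul_right, hx.2.2.1,
            hiso y hy w hw, (horth y (hUS' hy)).1, (horth w (hUS' hw)).2]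
          simp
    · push Not at hred
      obtain ⟨e, heS, he0, he⟩ := exists_orthogonal_family A d S hd hred
      exact exists_isotropic_of_orthogonal_family hd h heS he0 he

end Forms

/-! ### Translation between matrices and forms; density. -/

section Matrices

open Module

theorem star_mulVec_dotProduct {m r : ℕ} (M : Matrix (Fin m) (Fin r) ℂ) (x : Fin r → ℂ)
    (y : Fin m → ℂ) : star (M *ᵥ x) ⬝ᵥ y = star x ⬝ᵥ (Mᴴ *ᵥ y) := by
  rw [Matrix.star_mulVec, Matrix.dotProduct_mulVec]

/-- `M` maps `ℂ^r` isometrically onto the range of `M * Mᴴ`, with inverse `Mᴴ` there. -/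
theorem compressionNumericalRange_eq {n r : ℕ} {M : Matrix (Fin n) (Fin r) ℂ}
    (hM : M ∈ isometries n r) (A : Matrix (Fin n) (Fin n) ℂ) :
    compressionNumericalRange (M * Mᴴ) A = numericalRange (Mᴴ * A * M) := by
  have hM' : Mᴴ * M = 1 := hM
  ext z
  constructor
  · rintro ⟨x, hx, hxx, rfl⟩
    have h1 : star x ⬝ᵥ (M *ᵥ (Mᴴ *ᵥ x)) = star (Mᴴ *ᵥ x) ⬝ᵥ (Mᴴ *ᵥ x) := by
      rw [star_mulVec_dotProduct, Matrix.conjTranspose_conjTranspose]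
    refine ⟨Mᴴ *ᵥ x, ?_, ?_⟩
    · rw [← h1, Matrix.mulVec_mulVec, hx, hxx]
    · rw [star_mulVec_dotProduct, Matrix.conjTranspose_conjTranspose]
      simp only [Matrix.mulVec_mulVec, Matrix.mul_assoc]
  · rintro ⟨y, hy, rfl⟩
    have h1 : ∀ w, Mᴴ *ᵥ (M *ᵥ w) = w := fun w => by
      rw [Matrix.mulVec_mulVec, hM', Matrix.one_mulVec]
    refine ⟨M *ᵥ y, ?_, ?_, ?_⟩
    · rw [← Matrix.mulVec_mulVec, h1]
    · rw [star_mulVec_dotProduct, h1, hy]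
    · rw [star_mulVec_dotProduct]
      simp only [← Matrix.mulVec_mulVec, h1]

theorem dotProduct_star_self_eq_ofReal {m : ℕ} (v : Fin m → ℂ) :
    star v ⬝ᵥ v = ((∑ i, Complex.normSq (v i) : ℝ) : ℂ) := by
  simp [dotProduct, Complex.normSq_eq_conj_mul_self]

theorem mem_numericalRange_of_ne_zero {m : ℕ} {B : Matrix (Fin m) (Fin m) ℂ} {z : ℂ}
    {v : Fin m → ℂ} (hv : v ≠ 0) (h : star v ⬝ᵥ (B *ᵥ v) = z * (star v ⬝ᵥ v)) :
    z ∈ numericalRange B := by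
  set s : ℝ := ∑ i, Complex.normSq (v i) with hs
  have hvs : star v ⬝ᵥ v = (s : ℂ) := dotProduct_star_self_eq_ofReal v
  have hs0 : 0 < s := by
    obtain ⟨i, hi⟩ := Function.ne_iff.1 hv
    exact Finset.sum_pos' (fun j _ => Complex.normSq_nonneg _)
      ⟨i, Finset.mem_univ i, Complex.normSq_pos.2 hi⟩
  have hc : ((√s : ℝ) : ℂ)⁻¹ * (((√s : ℝ) : ℂ)⁻¹ * s) = 1 := by
    rw [← mul_assoc, ← mul_inv, ← Complex.ofReal_mul, Real.mul_self_sqrt hs0.le,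
      inv_mul_cancel₀ (Complex.ofReal_ne_zero.2 hs0.ne')]
  have hstar : star (((√s : ℝ) : ℂ)⁻¹ • v) = ((√s : ℝ) : ℂ)⁻¹ • star v := by
    rw [star_smul, Complex.star_def, map_inv₀, Complex.conj_ofReal]
  refine ⟨((√s : ℝ) : ℂ)⁻¹ • v, ?_, ?_⟩
  · rw [hstar, smul_dotProduct, dotProduct_smul, hvs, smul_eq_mul, smul_eq_mul, hc]
  · rw [hstar, Matrix.mulVec_smul, smul_dotProduct, dotProduct_smul, h, hvs, smul_eq_mul,
      smul_eq_mul]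
    linear_combination -z * hc

/-- The easy inclusion: a `k`-dimensional and an `n - k + 1`-dimensional subspace of `ℂⁿ` meet. -/
theorem rankNumericalRange_subset {n k r : ℕ} (hkr : n < k + r) {M : Matrix (Fin n) (Fin r) ℂ}
    (hM : M ∈ isometries n r) (A : Matrix (Fin n) (Fin n) ℂ) :
    rankNumericalRange k A ⊆ numericalRange (Mᴴ * A * M) := by
  rintro z ⟨X, hX, hXA⟩
  have hM' : Mᴴ * M = 1 := hM
  have hX' : Xᴴ * X = 1 := hX
  let f : (Fin k → ℂ) × (Fin r → ℂ) →ₗ[ℂ] (Fin n → ℂ) :=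
    X.mulVecLin.coprod (-M.mulVecLin)
  obtain ⟨⟨u, v⟩, huv, huv0⟩ := (Submodule.ne_bot_iff _).1
    (LinearMap.ker_ne_bot_of_finrank_lt (f := f) (by simpa using hkr))
  have hXM : X *ᵥ u = M *ᵥ v := by
    have : X *ᵥ u + -(M *ᵥ v) = 0 := huv
    exact add_neg_eq_zero.1 this
  have hu : Xᴴ *ᵥ (X *ᵥ u) = u := by rw [Matrix.mulVec_mulVec, hX', Matrix.one_mulVec]
  have hv : Mᴴ *ᵥ (M *ᵥ v) = v := by rw [Matrix.mulVec_mulVec, hM', Matrix.one_mulVec]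
  refine mem_numericalRange_of_ne_zero (v := v) ?_ ?_
  · rintro rfl
    rw [Matrix.mulVec_zero] at hXM
    rw [hXM, Matrix.mulVec_zero] at hu
    exact huv0 (by rw [← hu]; rfl)
  · calc star v ⬝ᵥ ((Mᴴ * A * M) *ᵥ v)
        = star (M *ᵥ v) ⬝ᵥ (A *ᵥ (M *ᵥ v)) := by
          rw [star_mulVec_dotProduct]
          simp only [Matrix.mulVec_mulVec, Matrix.mul_assoc]
      _ = star u ⬝ᵥ ((Xᴴ * A * X) *ᵥ u) := by
          rw [← hXM, star_mulVec_dotProduct]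
          simp only [Matrix.mulVec_mulVec, Matrix.mul_assoc]
      _ = z * (star (X *ᵥ u) ⬝ᵥ (X *ᵥ u)) := by
          rw [hXA, Matrix.smul_mulVec, Matrix.one_mulVec, dotProduct_smul, smul_eq_mul,
            star_mulVec_dotProduct, hu]
      _ = z * (star v ⬝ᵥ v) := by rw [hXM, star_mulVec_dotProduct, hv]

theorem isCompact_unit_vectors (n : ℕ) : IsCompact {x : Fin n → ℂ | star x ⬝ᵥ x = 1} := by
  refine (isCompact_closedBall (0 : Fin n → ℂ) 1).of_isClosed_subset
    (isClosed_eq (by fun_prop) continuous_const) fun x (hx : star x ⬝ᵥ x = 1) => ?_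
  rw [dotProduct_star_self_eq_ofReal, Complex.ofReal_eq_one] at hx
  rw [mem_closedBall_zero_iff, pi_norm_le_iff_of_nonneg zero_le_one]
  intro i
  have h1 : Complex.normSq (x i) ≤ 1 := by
    rw [← hx]
    exact Finset.single_le_sum (f := fun i => Complex.normSq (x i))
      (fun j _ => Complex.normSq_nonneg _) (Finset.mem_univ i)
  rw [Complex.normSq_eq_norm_sq] at h1
  exact (sq_le_one_iff₀ (norm_nonneg _)).1 h1

/-- The set is the projection of a closed set along the compact unit sphere. This is what lets a
dense family replace all projections. -/
theorem isClosed_mem_compressionNumericalRange {n : ℕ} (A : Matrix (Fin n) (Fin n) ℂ) (z : ℂ) :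
    IsClosed {P : Matrix (Fin n) (Fin n) ℂ | z ∈ compressionNumericalRange P A} := by
  have : CompactSpace {x : Fin n → ℂ | star x ⬝ᵥ x = 1} :=
    isCompact_iff_compactSpace.1 (isCompact_unit_vectors n)
  have hcl : IsClosed {p : Matrix (Fin n) (Fin n) ℂ × {x : Fin n → ℂ | star x ⬝ᵥ x = 1} |
      p.1 *ᵥ p.2.1 = p.2.1 ∧ z = star p.2.1 ⬝ᵥ ((p.1 * A * p.1) *ᵥ p.2.1)} :=
    (isClosed_eq (by fun_prop) (by fun_prop)).inter (isClosed_eq (by fun_prop) (by fun_prop))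
  convert isClosedMap_fst_of_compactSpace _ hcl using 1
  ext P
  constructor
  · rintro ⟨x, h1, h2, h3⟩
    exact ⟨(P, ⟨x, h2⟩), ⟨h1, h3⟩, rfl⟩
  · rintro ⟨⟨P, x, h2⟩, ⟨h1, h3⟩, rfl⟩
    exact ⟨x, h1, h2, h3⟩

/-- The matrix whose columns are the given vectors. -/
def columns {n r : ℕ} (b : Fin r → EuclideanSpace ℂ (Fin n)) : Matrix (Fin n) (Fin r) ℂ :=
  Matrix.of fun i j => b j i

theorem conjTranspose_columns_mul_mul {n r : ℕ} (b : Fin r → EuclideanSpace ℂ (Fin n))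
    (B : Matrix (Fin n) (Fin n) ℂ) :
    (columns b)ᴴ * B * columns b =
      Matrix.of fun j l => inner ℂ (b j) (Matrix.toEuclideanLin B (b l)) := by
  ext j l
  rw [Matrix.mul_assoc, Matrix.of_apply, EuclideanSpace.inner_eq_star_dotProduct, dotProduct_comm]
  rfl

theorem columns_mem_isometries {n r : ℕ} {b : Fin r → EuclideanSpace ℂ (Fin n)}
    (hb : Orthonormal ℂ b) : columns b ∈ isometries n r := by
  have h := conjTranspose_columns_mul_mul b 1
  rw [Matrix.mul_one] at h
  change (columns b)ᴴ * columns b = 1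
  rw [h]
  ext j l
  rw [Matrix.of_apply, Matrix.toLpLin_one, LinearMap.id_apply, orthonormal_iff_ite.1 hb,
    Matrix.one_apply]

/-- If every `n - k + 1`-dimensional compression has `z` in its numerical range, then the form
of `A - z` has no large negative definite subspace. -/
theorem negBound_of_forall_mem {n k r : ℕ} (hkr : k + r = n + 1) {A : Matrix (Fin n) (Fin n) ℂ}
    {z : ℂ} (h : ∀ M ∈ isometries n r, z ∈ compressionNumericalRange (M * Mᴴ) A) :
    NegBound (Matrix.toEuclideanLin (A - z • (1 : Matrix (Fin n) (Fin n) ℂ))) ⊤ k := by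
  intro ζ W _ hW
  by_contra! hlt
  rw [finrank_top, finrank_euclideanSpace_fin] at hlt
  have hr : r ≤ finrank ℂ W := by omega
  -- A negative definite `W` of dimension at least `r` contains the range of a rank-`r` isometry,
  -- hence a unit vector isotropic for `A - z`.
  let b : Fin r → EuclideanSpace ℂ (Fin n) :=
    fun j => (stdOrthonormalBasis ℂ W (Fin.castLE hr j) : W)
  have hb : Orthonormal ℂ b :=
    ((stdOrthonormalBasis ℂ W).orthonormal.comp _ (Fin.castLE_injective hr)).comp_linearIsometry
      W.subtypeₗᵢ
  obtain ⟨y, hy, hz⟩ := compressionNumericalRange_eq (columns_mem_isometries hb) A ▸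
    h _ (columns_mem_isometries hb)
  have hM : (columns b)ᴴ * columns b = 1 := columns_mem_isometries hb
  set x : EuclideanSpace ℂ (Fin n) := WithLp.toLp 2 (columns b *ᵥ y) with hx
  have hxsum : x = ∑ j, y j • b j := by
    ext i
    simp [hx, Matrix.mulVec, dotProduct, columns, mul_comm]
  have hxW : x ∈ W := by
    rw [hxsum]
    exact W.sum_mem fun j _ => W.smul_mem _ (Subtype.coe_prop _)
  have hxx : star (columns b *ᵥ y) ⬝ᵥ (columns b *ᵥ y) = 1 := by
    rw [star_mulVec_dotProduct, Matrix.mulVec_mulVec, hM, Matrix.one_mulVec, hy]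
  have hx0 : x ≠ 0 := by
    intro h0
    have h1 : columns b *ᵥ y = 0 := congrArg WithLp.ofLp h0
    rw [h1] at hxx
    simp at hxx
  have h2 : inner ℂ x (Matrix.toEuclideanLin (A - z • (1 : Matrix (Fin n) (Fin n) ℂ)) x) = 0 := by
    rw [EuclideanSpace.inner_eq_star_dotProduct, dotProduct_comm]
    change star (columns b *ᵥ y) ⬝ᵥ
      ((A - z • (1 : Matrix (Fin n) (Fin n) ℂ)) *ᵥ (columns b *ᵥ y)) = 0
    rw [Matrix.sub_mulVec, dotProduct_sub, Matrix.smul_mulVec, Matrix.one_mulVec, dotProduct_smul,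
      hxx, hz, star_mulVec_dotProduct]
    simp only [Matrix.mulVec_mulVec, Matrix.mul_assoc, smul_eq_mul, mul_one, sub_self]
  have h3 := hW x hxW hx0
  rw [h2] at h3
  simp at h3

/-- An orthonormal basis of a `k`-dimensional isotropic subspace for `A - z` gives the columns of
the required isometry. -/
theorem mem_rankNumericalRange_of_negBound {n k : ℕ} {A : Matrix (Fin n) (Fin n) ℂ} {z : ℂ}
    (h : NegBound (Matrix.toEuclideanLin (A - z • (1 : Matrix (Fin n) (Fin n) ℂ))) ⊤ k) :
    z ∈ rankNumericalRange k A := by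
  obtain ⟨U, -, hU, hiso⟩ := h.exists_isotropic
  let b : Fin k → EuclideanSpace ℂ (Fin n) :=
    fun j => (stdOrthonormalBasis ℂ U (Fin.cast hU.symm j) : U)
  have hb : Orthonormal ℂ b :=
    ((stdOrthonormalBasis ℂ U).orthonormal.comp _ (Fin.cast_injective hU.symm)).comp_linearIsometry
      U.subtypeₗᵢ
  have hM : (columns b)ᴴ * columns b = 1 := columns_mem_isometries hb
  refine ⟨columns b, hM, ?_⟩
  have h1 : (columns b)ᴴ * (A - z • (1 : Matrix (Fin n) (Fin n) ℂ)) * columns b = 0 := by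
    rw [conjTranspose_columns_mul_mul]
    ext j l
    exact hiso _ (Subtype.coe_prop _) _ (Subtype.coe_prop _)
  rw [Matrix.mul_sub, Matrix.sub_mul, Matrix.mul_smul, Matrix.smul_mul, Matrix.mul_one, hM] at h1
  exact sub_eq_zero.1 h1

theorem isometries_nonempty {n r : ℕ} (h : r ≤ n) : (isometries n r).Nonempty :=
  ⟨_, columns_mem_isometries ((EuclideanSpace.basisFun (Fin n) ℂ).orthonormal.comp _
    (Fin.castLE_injective h))⟩

theorem exists_denseRange_projections {n r : ℕ} (h : r ≤ n) :
    ∃ P : ℕ → projections n r, DenseRange P := by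
  obtain ⟨X, hX⟩ := isometries_nonempty h
  have : Nonempty (projections n r) := ⟨⟨X * Xᴴ, X, hX, rfl⟩⟩
  have : SecondCountableTopology (Matrix (Fin n) (Fin n) ℂ) :=
    inferInstanceAs (SecondCountableTopology (Fin n → Fin n → ℂ))
  exact TopologicalSpace.exists_dense_seq _

end Matrices

end HigherRank

/-! ### The main theorem. -/

theorem theorem2p2 (n k : ℕ) (hk : 1 ≤ k) (hkn : k ≤ n) :
    (∃ (P : ℕ → HigherRank.projections n (n - k + 1))
        (M : ℕ → HigherRank.isometries n (n - k + 1)),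
      DenseRange P ∧
        ∀ ν, (P ν : Matrix (Fin n) (Fin n) ℂ) = (M ν).val * ((M ν).val)ᴴ) ∧
    ∀ (P : ℕ → HigherRank.projections n (n - k + 1))
      (M : ℕ → HigherRank.isometries n (n - k + 1)),
      DenseRange P →
      (∀ ν, (P ν : Matrix (Fin n) (Fin n) ℂ) = (M ν).val * ((M ν).val)ᴴ) →
      ∀ A : Matrix (Fin n) (Fin n) ℂ,
        HigherRank.rankNumericalRange k A =
            ⋂ ν : ℕ, HigherRank.compressionNumericalRange (P ν).val A ∧
          HigherRank.rankNumericalRange k A =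
            ⋂ ν : ℕ, HigherRank.numericalRange (((M ν).val)ᴴ * A * (M ν).val) := by
  constructor
  · obtain ⟨P, hP⟩ := HigherRank.exists_denseRange_projections (n := n) (r := n - k + 1) (by omega)
    choose M hM hPM using fun ν => (P ν).2
    exact ⟨P, fun ν => ⟨M ν, hM ν⟩, hP, hPM⟩
  · intro P M hP hPM A
    have heq : ∀ ν, HigherRank.compressionNumericalRange (P ν).val A =
        HigherRank.numericalRange (((M ν).val)ᴴ * A * (M ν).val) := fun ν => by
      rw [hPM ν, HigherRank.compressionNumericalRange_eq (M ν).2]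
    simp only [heq, and_self]
    refine Set.Subset.antisymm (Set.subset_iInter fun ν =>
      HigherRank.rankNumericalRange_subset (by omega) (M ν).2 A) fun z hz => ?_
    refine HigherRank.mem_rankNumericalRange_of_negBound
      (HigherRank.negBound_of_forall_mem (r := n - k + 1) (by omega) fun X hX => ?_)
    have hcl := (HigherRank.isClosed_mem_compressionNumericalRange A z).preimage
      (continuous_subtype_val (p := (· ∈ HigherRank.projections n (n - k + 1))))
    -- A closed condition that holds at every `P ν` holds at every projection, in particular at `X *
    -- Xᴴ`.
    exact hP.induction_on (p := fun Q => z ∈ HigherRank.compressionNumericalRange Q.val A)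
      ⟨X * Xᴴ, X, hX, rfl⟩ hcl fun ν => heq ν ▸ Set.mem_iInter.1 hz ν
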